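/- Let $L$ be a co-Heyting algebra, i.e. a bounded lattice with an operation $-$ satisfying $a-b\le c \iff a\le b\vee c$. Let $\operatorname{Spec} L$ be its set of prime filters ordered by inclusion. The height of a prime filter is its foundation rank in $\operatorname{Spec}L$ (for finite $n$: height $\ge n$ iff there is a chain $\mathfrak p_0\subsetneq\dots\subsetneq\mathfrak p_n=\mathfrak p$ of prime filters). For $a\in L$ let $\operatorname{codim} a=\min\{\operatorname{height}\mathfrak p : \mathfrak p\in\operatorname{Spec}L,\ a\in\mathfrak p\}$ ($+\infty$ if there is no such $\mathfrak p$), and for every positive integer $d$ let $dL$ be the ideal $\{a\in L : \operatorname{codim} a\ge d\}$. Write $a\bigtriangleup b=(a-b)\vee(b-a)$, and let $L/dL$ be the quotient of $L$ by the congruence $a\equiv b\iff a\bigtriangleup b\in dL$. Equip $L$ with the pseudometric $\delta(a,b)=2^{-\operatorname{codim}(a\bigtriangleup b)}$ if $\operatorname{codim}(a\bigtriangleup b)$ is finite, and $\delta(a,b)=0$ otherwise. Say that $L$ is precompact if $L/dL$ is finite for every positive integer $d$, and Hausdorff if the topology of $\delta$ is Hausdorff. Every finitely generated co-Heyting algebra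 is precompact. Every finitely presented co-Heyting algebra (one isomorphic to the co-Heyting algebra given by finitely many generators and finitely many relations) is precompact and Hausdorff. -/

import Mathlib

namespace CoHeyting

/-! ### Prime filters and codimension -/

section Codimension

variable (L : Type*) [CoheytingAlgebra L]

/-- The prime filter spectrum of `L`, ordered by inclusion. -/
abbrev Spec : Type _ := {p : Order.PFilter L // p.IsPrime}

variable {L}

/-- The codimension of `a`: the least height of a prime filter containing `a`, and `⊤` if there is
none. `Order.height p` is the supremum of the lengths of the chains of prime filters ending at `p`,
so all infinite values of the ordinal-valued foundation rank are identified with `⊤`. -/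
noncomputable def codim (a : L) : ℕ∞ := ⨅ p : {p : Spec L // a ∈ p.1}, Order.height p.1

theorem le_codim_iff {d : ℕ∞} {a : L} :
    d ≤ codim a ↔ ∀ p : Spec L, a ∈ p.1 → d ≤ Order.height p := by
  simp only [codim, le_iInf_iff, Subtype.forall]

theorem codim_bot : codim (⊥ : L) = ⊤ := by
  refine top_unique (le_codim_iff.2 fun p hp => ?_)
  obtain ⟨a, ha⟩ := p.2.compl_ideal.Nonempty
  exact absurd (p.1.mem_of_le bot_le hp) ha

theorem codim_anti {a b : L} (h : a ≤ b) : codim b ≤ codim a :=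
  le_codim_iff.2 fun p hp => le_codim_iff.1 le_rfl p (p.1.mem_of_le h hp)

theorem le_codim_sup {d : ℕ∞} {a b : L} (ha : d ≤ codim a) (hb : d ≤ codim b) :
    d ≤ codim (a ⊔ b) := by
  refine le_codim_iff.2 fun p hp => ?_
  by_cases h1 : a ∈ p.1
  · exact le_codim_iff.1 ha p h1
  by_cases h2 : b ∈ p.1
  · exact le_codim_iff.1 hb p h2
  exfalso
  obtain ⟨c, hc, hac, hbc⟩ := p.2.compl_ideal.Directed a h1 b h2
  exact hc (p.1.mem_of_le (sup_le hac hbc) hp)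

theorem symmDiff_triangle_le (a b c : L) :
    symmDiff a c ≤ symmDiff a b ⊔ symmDiff b c := by
  refine sup_le ?_ ?_
  · exact (sdiff_triangle a b c).trans (sup_le_sup le_sup_left le_sup_left)
  · refine (sdiff_triangle c b a).trans ?_
    rw [sup_comm (c \ b)]
    exact sup_le_sup le_sup_right le_sup_right

variable (L) in
/-- The ideal `dL` of elements of codimension at least `d`. -/
noncomputable def codimIdeal (d : ℕ) : Order.Ideal L where
  carrier := {a | (d : ℕ∞) ≤ codim a}
  lower' := fun _ _ hab ha => le_trans ha (codim_anti hab)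
  nonempty' := ⟨⊥, by simp [codim_bot]⟩
  directed' := fun a ha b hb => ⟨a ⊔ b, le_codim_sup ha hb, le_sup_left, le_sup_right⟩

/-- The congruence associated with an ideal `I`: `a ≡ b` iff the symmetric difference
`(a \ b) ⊔ (b \ a)` belongs to `I`. Its quotient is `L/I`. -/
def idealSetoid (I : Order.Ideal L) : Setoid L where
  r a b := symmDiff a b ∈ I
  iseqv :=
    { refl := fun a => by simp
      symm := fun {a b} h => by rwa [symmDiff_comm]
      trans := fun {a b c} h1 h2 =>
        I.lower (symmDiff_triangle_le a b c) (Order.Ideal.sup_mem h1 h2) }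

variable (L) in
/-- `L` is precompact if `L/dL` is finite for every positive integer `d`. -/
def Precompact : Prop :=
  ∀ d : ℕ, 0 < d → Finite (Quotient (idealSetoid (codimIdeal L d)))

/-! ### The codimetric topology -/

/-- `2 ^ (-codim (a ∆ b))` if this codimension is finite, and `0` otherwise. -/
noncomputable def codimDist (a b : L) : ℝ :=
  if codim (symmDiff a b) = ⊤ then 0 else (1 / 2 : ℝ) ^ (codim (symmDiff a b)).toNat

theorem codimDist_nonneg (a b : L) : 0 ≤ codimDist a b := by
  unfold codimDist; split_ifs <;> positivity

theorem codimDist_triangle (a b c : L) : codimDist a c ≤ codimDist a b + codimDist b c := by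
  have key : min (codim (symmDiff a b)) (codim (symmDiff b c)) ≤ codim (symmDiff a c) :=
    (le_codim_sup (min_le_left _ _) (min_le_right _ _)).trans
      (codim_anti (symmDiff_triangle_le a b c))
  have aux : ∀ x y : L, codim (symmDiff x y) ≤ codim (symmDiff a c) →
      codimDist a c ≤ codimDist x y := by
    intro x y h
    by_cases hac : codim (symmDiff a c) = ⊤
    · simpa [codimDist, hac] using codimDist_nonneg x y
    · have hxy : codim (symmDiff x y) ≠ ⊤ := fun e => hac (top_unique (e ▸ h))
      simp only [codimDist, hac, hxy, if_false]
      exact pow_le_pow_of_le_one (by norm_num) (by norm_num) (ENat.toNat_le_toNat h hac)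
  rcases min_le_iff.1 key with h | h
  · linarith [aux a b h, codimDist_nonneg b c]
  · linarith [aux b c h, codimDist_nonneg a b]

variable (L) in
/-- The pseudometric of `L`. -/
noncomputable abbrev codimetric : PseudoMetricSpace L where
  dist := codimDist
  dist_self a := by simp [codimDist, codim_bot]
  dist_comm a b := by simp only [codimDist, symmDiff_comm]
  dist_triangle := codimDist_triangle

variable (L) in
/-- `L` is Hausdorff if the topology of its pseudometric is. -/
def IsHausdorff : Prop :=
  @T2Space L (codimetric L).toUniformSpace.toTopologicalSpace

end Codimension

/-! ### Terms, finite generation and finite presentation -/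

/-- Terms in the language `{⊥, ⊤, ⊔, ⊓, \}` with variables in `X`. -/
inductive Term (X : Type) : Type
  | var : X → Term X
  | bot : Term X
  | top : Term X
  | sup : Term X → Term X → Term X
  | inf : Term X → Term X → Term X
  | sdiff : Term X → Term X → Term X

/-- The value of a term in a co-Heyting algebra. -/
def Term.eval {X : Type} {L : Type*} [CoheytingAlgebra L] (x : X → L) : Term X → L
  | var i => x i
  | bot => ⊥
  | top => ⊤
  | sup s t => s.eval x ⊔ t.eval x
  | inf s t => s.eval x ⊓ t.eval x
  | sdiff s t => s.eval x \ t.eval x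

/-- `L` is finitely generated: every element is the value of a term at a fixed finite tuple. -/
def FinitelyGenerated (L : Type*) [CoheytingAlgebra L] : Prop :=
  ∃ (n : ℕ) (x : Fin n → L), ∀ a : L, ∃ t : Term (Fin n), t.eval x = a

section Presentation

variable {X : Type} (R : Set (Term X × Term X))

/-- The inequalities between terms that follow from the axioms of co-Heyting algebras and the
relations `s = t` for `(s, t) ∈ R`. -/
inductive Entails : Term X → Term X → Prop
  | refl (s) : Entails s s
  | trans {s t u} : Entails s t → Entails t u → Entails s u
  | bot_le (s) : Entails .bot s
  | le_top (s) : Entails s .top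
  | le_sup_left (s t) : Entails s (.sup s t)
  | le_sup_right (s t) : Entails t (.sup s t)
  | sup_le {s t u} : Entails s u → Entails t u → Entails (.sup s t) u
  | inf_le_left (s t) : Entails (.inf s t) s
  | inf_le_right (s t) : Entails (.inf s t) t
  | le_inf {s t u} : Entails s t → Entails s u → Entails s (.inf t u)
  | sdiff_le {s t u} : Entails s (.sup t u) → Entails (.sdiff s t) u
  | le_sup_of_sdiff_le {s t u} : Entails (.sdiff s t) u → Entails s (.sup t u)
  | rel {s t} : (s, t) ∈ R → Entails s t
  | rel_symm {s t} : (s, t) ∈ R → Entails t s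

/-- Two terms are identified if each of the two inequalities between them is derivable. -/
def presentedSetoid : Setoid (Term X) where
  r s t := Entails R s t ∧ Entails R t s
  iseqv :=
    { refl := fun s => ⟨.refl s, .refl s⟩
      symm := fun h => ⟨h.2, h.1⟩
      trans := fun h k => ⟨h.1.trans k.1, k.2.trans h.2⟩ }

/-- The co-Heyting algebra with generators `X` and relations `s = t` for `(s, t) ∈ R`
(the free co-Heyting algebra on `X` if `R` is empty). -/
def Presented : Type := Quotient (presentedSetoid R)

namespace Entails

variable {R} {s t u v : Term X}

theorem sup_congr (h : Entails R s t) (k : Entails R u v) : Entails R (.sup s u) (.sup t v) :=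
  .sup_le (h.trans (.le_sup_left _ _)) (k.trans (.le_sup_right _ _))

theorem inf_congr (h : Entails R s t) (k : Entails R u v) : Entails R (.inf s u) (.inf t v) :=
  .le_inf ((Entails.inf_le_left _ _).trans h) ((Entails.inf_le_right _ _).trans k)

theorem sdiff_congr (h : Entails R s t) (k : Entails R v u) :
    Entails R (.sdiff s u) (.sdiff t v) :=
  .sdiff_le (h.trans ((Entails.le_sup_of_sdiff_le (.refl _)).trans (sup_congr k (.refl _))))

end Entails

instance : CoheytingAlgebra (Presented R) where
  le := Quotient.lift₂ (Entails R) fun _ _ _ _ h k =>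
    propext ⟨fun e => h.2.trans (e.trans k.1), fun e => h.1.trans (e.trans k.2)⟩
  le_refl := by rintro ⟨a⟩; exact Entails.refl a
  le_trans := by rintro ⟨a⟩ ⟨b⟩ ⟨c⟩ h k; exact Entails.trans h k
  le_antisymm := by rintro ⟨a⟩ ⟨b⟩ h k; exact Quotient.sound ⟨h, k⟩
  sup := Quotient.map₂ Term.sup fun _ _ h _ _ k =>
    ⟨Entails.sup_congr h.1 k.1, Entails.sup_congr h.2 k.2⟩
  le_sup_left := by rintro ⟨a⟩ ⟨b⟩; exact Entails.le_sup_left a b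
  le_sup_right := by rintro ⟨a⟩ ⟨b⟩; exact Entails.le_sup_right a b
  sup_le := by rintro ⟨a⟩ ⟨b⟩ ⟨c⟩ h k; exact Entails.sup_le h k
  inf := Quotient.map₂ Term.inf fun _ _ h _ _ k =>
    ⟨Entails.inf_congr h.1 k.1, Entails.inf_congr h.2 k.2⟩
  inf_le_left := by rintro ⟨a⟩ ⟨b⟩; exact Entails.inf_le_left a b
  inf_le_right := by rintro ⟨a⟩ ⟨b⟩; exact Entails.inf_le_right a b
  le_inf := by rintro ⟨a⟩ ⟨b⟩ ⟨c⟩ h k; exact Entails.le_inf h k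
  bot := Quotient.mk _ Term.bot
  bot_le := by rintro ⟨a⟩; exact Entails.bot_le a
  top := Quotient.mk _ Term.top
  le_top := by rintro ⟨a⟩; exact Entails.le_top a
  sdiff := Quotient.map₂ Term.sdiff fun _ _ h _ _ k =>
    ⟨Entails.sdiff_congr h.1 k.2, Entails.sdiff_congr h.2 k.1⟩
  sdiff_le_iff := by
    rintro ⟨a⟩ ⟨b⟩ ⟨c⟩
    exact ⟨fun h => Entails.le_sup_of_sdiff_le h, fun h => Entails.sdiff_le h⟩
  hnot := Quotient.map (Term.sdiff Term.top) fun _ _ h =>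
    ⟨Entails.sdiff_congr (.refl _) h.2, Entails.sdiff_congr (.refl _) h.1⟩
  top_sdiff := by rintro ⟨a⟩; rfl

end Presentation

/-- `L` is finitely presented: it is isomorphic to the co-Heyting algebra given by finitely many
generators and finitely many relations. -/
def FinitelyPresented (L : Type*) [CoheytingAlgebra L] : Prop :=
  ∃ (n : ℕ) (R : Set (Term (Fin n) × Term (Fin n))), R.Finite ∧
    ∃ f : CoheytingHom (Presented R) L, Function.Bijective f

end CoHeyting

/-!
*Precompactness.* A prime filter contains `a \ b` iff some prime filter below it contains `a` but
not `b` (`sdiff_mem_iff`). Hence two elements are congruent modulo `dL` as soon as they lie in the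
same prime filters of height less than `d`, so it suffices that a finitely generated algebra has
only finitely many of those (`finite_setOf_height_lt`). This is an induction on `d`: by induction
on terms, a prime filter `p` is determined by the generators it contains together with the set of
prime filters strictly below it (`eq_of_forall_mem_iff_of_Iio_eq`), and these have smaller height.

*Hausdorffness.* The topology of `δ` is Hausdorff iff every `a ≠ ⊥` has finite codimension. This
holds whenever a homomorphism `f` to a finite algebra does not kill `a`: a prime filter containing
`a` and disjoint from the kernel of `f` has only finitely many prime filters below it, because
each of them is the preimage of its image under `f` (`codim_lt_top_of_map_ne_bot`). In a finitely
presented algebra such an `f` exists (`Presented.exists_finite_map_ne_bot`): the values of the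
subterms of the relations and of a term for `a`, together with `⊥` and `⊤`, generate a finite
sublattice. Being finite and distributive, it is a co-Heyting algebra in its own right, and its
difference agrees with that of the ambient algebra whenever the latter belongs to the sublattice.
Hence the relations still hold there, and `a` keeps its value.
-/

universe u

namespace CoHeyting

/-! ### Prime filters of a co-Heyting algebra -/

section PrimeFilters

variable {L : Type*} [CoheytingAlgebra L]

/-- The prime filter theorem: an element outside an ideal belongs to a prime filter that does not
meet the ideal. -/
theorem exists_spec_mem_disjoint {a : L} {I : Order.Ideal L} (h : a ∉ I) :
    ∃ p : Spec L, a ∈ p.1 ∧ ∀ b ∈ I, b ∉ p.1 := by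
  have hd : Disjoint (Order.PFilter.principal a : Set L) (I : Set L) :=
    Set.disjoint_left.2 fun b hab hb => h (I.lower hab hb)
  obtain ⟨J, hJ, hIJ, haJ⟩ := DistribLattice.prime_ideal_of_disjoint_filter_ideal hd
  have key : ∀ b, b ∈ hJ.toPrimePair.F ↔ b ∉ J := fun b =>
    Set.ext_iff.1 hJ.toPrimePair.compl_I_eq_F.symm b
  refine ⟨⟨hJ.toPrimePair.F, hJ.toPrimePair.F_isPrime⟩, ?_, fun b hb => ?_⟩
  · exact (key a).2 (Set.disjoint_left.1 haJ (Order.PFilter.mem_principal.2 le_rfl))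
  · exact fun hbF => (key b).1 hbF (hIJ hb)

theorem bot_notMem (p : Spec L) : ⊥ ∉ p.1 := fun h => by
  obtain ⟨a, ha⟩ := p.2.compl_ideal.Nonempty
  exact ha (p.1.mem_of_le bot_le h)

theorem sup_mem_iff {p : Spec L} {a b : L} : a ⊔ b ∈ p.1 ↔ a ∈ p.1 ∨ b ∈ p.1 := by
  refine ⟨fun h => ?_, fun h => h.elim (p.1.mem_of_le le_sup_left) (p.1.mem_of_le le_sup_right)⟩
  by_contra! hc
  exact Order.Ideal.sup_mem (s := p.2.compl_ideal.toIdeal) hc.1 hc.2 h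

/-- `a \ b` belongs to `p` iff some prime filter below `p` contains `a` but not `b`. -/
theorem sdiff_mem_iff {p : Spec L} {a b : L} :
    a \ b ∈ p.1 ↔ ∃ q ≤ p, a ∈ q.1 ∧ b ∉ q.1 := by
  constructor
  · intro h
    have ha : a ∉ p.2.compl_ideal.toIdeal ⊔ Order.Ideal.principal b := by
      rw [Lattice.mem_ideal_sup_principal]
      rintro ⟨c, hc, hac⟩
      exact hc (p.1.mem_of_le (sdiff_le_iff.2 (sup_comm c b ▸ hac)) h)
    obtain ⟨q, haq, hq⟩ := exists_spec_mem_disjoint ha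
    refine ⟨q, fun c hcq => ?_, haq, hq b ?_⟩
    · by_contra hcp
      exact hq c ((le_sup_left : p.2.compl_ideal.toIdeal ≤ _) hcp) hcq
    · exact (le_sup_right : Order.Ideal.principal b ≤ _) (Order.Ideal.mem_principal.2 le_rfl)
  · rintro ⟨q, hqp, ha, hb⟩
    exact hqp ((sup_mem_iff.1 (q.1.mem_of_le (le_sup_sdiff : a ≤ b ⊔ a \ b) ha)).resolve_left hb)

end PrimeFilters

/-! ### Precompactness of finitely generated algebras -/

section Precompact

variable {L : Type*} [CoheytingAlgebra L]

/-- If `L` is generated by `x`, then a prime filter is determined by the generators that it contains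
and the set of prime filters strictly below it. -/
theorem eq_of_forall_mem_iff_of_Iio_eq {X : Type} {x : X → L}
    (hx : ∀ a : L, ∃ t : Term X, t.eval x = a) {p q : Spec L}
    (hgen : ∀ i, x i ∈ p.1 ↔ x i ∈ q.1) (hlt : Set.Iio p = Set.Iio q) : p = q := by
  have key : ∀ t : Term X, t.eval x ∈ p.1 ↔ t.eval x ∈ q.1 := by
    intro t
    induction t with
    | var i => exact hgen i
    | bot => exact iff_of_false (bot_notMem p) (bot_notMem q)
    | top => exact iff_of_true Order.PFilter.top_mem Order.PFilter.top_mem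
    | sup s t hs ht => simp only [Term.eval, sup_mem_iff, hs, ht]
    | inf s t hs ht => simp only [Term.eval, Order.PFilter.inf_mem_iff, hs, ht]
    | sdiff s t hs ht =>
      have hlt' : ∀ r, r < p ↔ r < q := fun r => Set.ext_iff.1 hlt r
      simp only [Term.eval, sdiff_mem_iff, le_iff_lt_or_eq, or_and_right, exists_or,
        exists_eq_left, hlt', hs, ht]
  refine Subtype.ext (SetLike.ext fun a => ?_)
  obtain ⟨t, rfl⟩ := hx a
  exact key t

/-- A prime filter `p` of height at most `d` has only prime filters of height less than `d` strictly
below it, so that induction bounds the number of possible sets `Set.Iio p`. -/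
theorem finite_setOf_height_lt (hL : FinitelyGenerated L) (d : ℕ) :
    {p : Spec L | Order.height p < d}.Finite := by
  obtain ⟨n, x, hx⟩ := hL
  induction d with
  | zero => simp
  | succ d ih =>
    let f : Spec L → Set (Fin n) × Set (Spec L) := fun p => ({i | x i ∈ p.1}, Set.Iio p)
    refine Set.Finite.of_finite_image (f := f)
      ((Set.finite_univ.prod ih.finite_subsets).subset ?_) ?_
    · rintro _ ⟨p, hp, rfl⟩
      refine ⟨Set.mem_univ _, fun q hq => ?_⟩
      have hp' : Order.height p ≤ d := Order.le_of_lt_add_one (by exact_mod_cast hp)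
      exact Order.height_le_coe_iff.1 hp' q hq
    · intro p _ q _ hpq
      obtain ⟨h1, h2⟩ := Prod.mk.inj hpq
      exact eq_of_forall_mem_iff_of_Iio_eq hx (fun i => Set.ext_iff.1 h1 i) h2

/-- A prime filter of height less than `d` containing `symmDiff a b` would lie above one that
separates `a` from `b`, and the latter has height less than `d` too. -/
theorem symmDiff_mem_codimIdeal {d : ℕ} {a b : L}
    (h : ∀ p : Spec L, Order.height p < d → (a ∈ p.1 ↔ b ∈ p.1)) :
    symmDiff a b ∈ codimIdeal L d := by
  refine le_codim_iff.2 fun p hp => ?_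
  by_contra! hlt
  have hq : ∀ q ≤ p, (a ∈ q.1 ↔ b ∈ q.1) := fun q hqp =>
    h q ((Order.height_mono hqp).trans_lt hlt)
  rcases sup_mem_iff.1 hp with hab | hba
  · obtain ⟨q, hqp, ha, hb⟩ := sdiff_mem_iff.1 hab
    exact hb ((hq q hqp).1 ha)
  · obtain ⟨q, hqp, hb, ha⟩ := sdiff_mem_iff.1 hba
    exact ha ((hq q hqp).2 hb)

theorem FinitelyGenerated.precompact (hL : FinitelyGenerated L) : Precompact L := by
  intro d _
  have := (finite_setOf_height_lt hL d).to_subtype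
  let f : Quotient (idealSetoid (codimIdeal L d)) → Set {p : Spec L | Order.height p < d} :=
    fun c => {p | c.out ∈ p.1.1}
  refine Finite.of_injective f fun c c' hc => Quotient.out_equiv_out.1 ?_
  exact symmDiff_mem_codimIdeal fun p hp => Set.ext_iff.1 hc ⟨p, hp⟩

end Precompact

/-! ### Finite codimension -/

section FiniteCodimension

theorem height_lt_top_of_finite_Iic {α : Type*} [PartialOrder α] {a : α}
    (h : (Set.Iic a).Finite) : Order.height a < ⊤ := by
  have := h.to_subtype
  refine lt_of_le_of_lt (Order.height_le (n := (Nat.card (Set.Iic a) : ℕ)) fun s hs => ?_)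
    (ENat.natCast_lt_top _)
  have hle : ∀ i, s i ≤ a := fun i => hs ▸ LTSeries.monotone s (Fin.le_last i)
  have hinj : Function.Injective fun i => (⟨s i, hle i⟩ : Set.Iic a) := fun i j hij =>
    (LTSeries.strictMono s).injective (Subtype.mk.inj hij)
  have hcard := Nat.card_le_card_of_injective _ hinj
  rw [Nat.card_eq_fintype_card, Fintype.card_fin] at hcard
  exact_mod_cast (Nat.le_succ _).trans hcard

variable {L : Type*} [CoheytingAlgebra L]

/-- The kernel of a co-Heyting homomorphism. -/
def ker {M : Type*} [CoheytingAlgebra M] (f : CoheytingHom L M) : Order.Ideal L where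
  carrier := {a | f a = ⊥}
  lower' a b hba ha := le_bot_iff.1 ((OrderHomClass.mono f hba).trans_eq ha)
  nonempty' := ⟨⊥, map_bot f⟩
  directed' a ha b hb :=
    ⟨a ⊔ b, by simp_all, le_sup_left, le_sup_right⟩

/-- A prime filter `p` that contains `a` and avoids the kernel of `f` has finite height, because each
prime filter below `p` is determined by its image under `f`, a subset of the finite algebra `M`. -/
theorem codim_lt_top_of_map_ne_bot {M : Type*} [CoheytingAlgebra M] [Finite M]
    (f : CoheytingHom L M) {a : L} (ha : f a ≠ ⊥) : codim a < ⊤ := by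
  obtain ⟨p, hap, hp⟩ := exists_spec_mem_disjoint (I := ker f) ha
  have hsat : ∀ q ≤ p, ∀ b, b ∈ q.1 ↔ f b ∈ f '' (q.1 : Set L) := by
    refine fun q hqp b => ⟨Set.mem_image_of_mem f, ?_⟩
    rintro ⟨c, hc, hcb⟩
    -- As `f c ≤ f b`, the element `c \ b` is in the kernel of `f`, which `q` avoids.
    have hker : c \ b ∈ ker f := by
      change f (c \ b) = ⊥
      rw [map_sdiff, hcb, sdiff_self]
    exact (sup_mem_iff.1 (q.1.mem_of_le (le_sup_sdiff : c ≤ b ⊔ c \ b) hc)).resolve_right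
      fun h => hp _ hker (hqp h)
  have hfin : (Set.Iic p).Finite := by
    refine Set.Finite.of_finite_image (f := fun q : Spec L => f '' (q.1 : Set L))
      (Set.toFinite _) fun q hq r hr hqr => Subtype.ext (SetLike.ext fun b => ?_)
    rw [hsat q hq, hsat r hr]
    exact Set.ext_iff.1 hqr (f b)
  exact (le_codim_iff.1 le_rfl p hap).trans_lt (height_lt_top_of_finite_Iic hfin)

/-- The distance of `a` and `b` is zero iff `symmDiff a b` has infinite codimension. -/
theorem isHausdorff_of_codim_lt_top (h : ∀ a : L, a ≠ ⊥ → codim a < ⊤) : IsHausdorff L := by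
  let _ : MetricSpace L :=
    { codimetric L with
      eq_of_dist_eq_zero := fun {a b} hab => by
        change codimDist a b = 0 at hab
        by_contra hne
        have hlt := h (symmDiff a b) fun e => hne (symmDiff_eq_bot.1 e)
        rw [codimDist, if_neg hlt.ne] at hab
        exact pow_ne_zero _ (by norm_num) hab }
  exact inferInstanceAs (T2Space L)

end FiniteCodimension

/-! ### Homomorphisms from finitely presented algebras to finite ones -/

section FinitePresentation

variable {X : Type}

theorem Term.map_eval {L M : Type*} [CoheytingAlgebra L] [CoheytingAlgebra M]
    (f : CoheytingHom L M) (x : X → L) (t : Term X) :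
    f (t.eval x) = t.eval (f ∘ x) := by
  induction t with
  | var i => rfl
  | bot => exact map_bot f
  | top => exact map_top f
  | sup s t hs ht => simp only [eval, map_sup, hs, ht]
  | inf s t hs ht => simp only [eval, map_inf, hs, ht]
  | sdiff s t hs ht => simp only [eval, map_sdiff, hs, ht]

/-- Soundness: a derivable inequality holds in every algebra that satisfies the relations. -/
theorem Entails.eval_le {R : Set (Term X × Term X)} {M : Type*} [CoheytingAlgebra M] {y : X → M}
    (hR : ∀ r ∈ R, r.1.eval y = r.2.eval y) {s t : Term X} (h : Entails R s t) :
    s.eval y ≤ t.eval y := by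
  induction h with
  | refl s => exact le_rfl
  | trans _ _ h k => exact h.trans k
  | bot_le s => exact _root_.bot_le
  | le_top s => exact _root_.le_top
  | le_sup_left s t => exact _root_.le_sup_left
  | le_sup_right s t => exact _root_.le_sup_right
  | sup_le _ _ h k => exact _root_.sup_le h k
  | inf_le_left s t => exact _root_.inf_le_left
  | inf_le_right s t => exact _root_.inf_le_right
  | le_inf _ _ h k => exact _root_.le_inf h k
  | sdiff_le _ h => exact sdiff_le_iff.2 h
  | le_sup_of_sdiff_le _ h => exact sdiff_le_iff.1 h
  | rel h => exact (hR _ h).le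
  | rel_symm h => exact (hR _ h).ge

namespace Presented

variable (R : Set (Term X × Term X))

/-- The generators of `Presented R`. -/
def of (i : X) : Presented R := Quotient.mk _ (.var i)

theorem eval_of (t : Term X) : t.eval (of R) = Quotient.mk (presentedSetoid R) t := by
  induction t with
  | var i => rfl
  | bot => rfl
  | top => rfl
  | sup s t hs ht => simp only [Term.eval, hs, ht]; rfl
  | inf s t hs ht => simp only [Term.eval, hs, ht]; rfl
  | sdiff s t hs ht => simp only [Term.eval, hs, ht]; rfl

theorem exists_eval_of_eq (a : Presented R) : ∃ t : Term X, t.eval (of R) = a := by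
  obtain ⟨t, rfl⟩ := Quotient.exists_rep a
  exact ⟨t, eval_of R t⟩

variable {R}

theorem eval_of_eq_of_mem {r : Term X × Term X} (hr : r ∈ R) :
    r.1.eval (of R) = r.2.eval (of R) := by
  rw [eval_of, eval_of]
  exact Quotient.sound ⟨.rel hr, .rel_symm hr⟩

/-- The universal property of `Presented R`. -/
def lift {M : Type*} [CoheytingAlgebra M] (y : X → M) (hR : ∀ r ∈ R, r.1.eval y = r.2.eval y) :
    CoheytingHom (Presented R) M where
  toFun := Quotient.lift (Term.eval y) fun _ _ h => (h.1.eval_le hR).antisymm (h.2.eval_le hR)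
  map_sup' := by rintro ⟨a⟩ ⟨b⟩; rfl
  map_inf' := by rintro ⟨a⟩ ⟨b⟩; rfl
  map_top' := rfl
  map_sdiff' := by rintro ⟨a⟩ ⟨b⟩; rfl

theorem lift_eval_of {M : Type*} [CoheytingAlgebra M] (y : X → M)
    (hR : ∀ r ∈ R, r.1.eval y = r.2.eval y) (t : Term X) :
    lift y hR (t.eval (of R)) = t.eval y := by
  rw [eval_of]
  rfl

end Presented

/-- The values, under the assignment `x`, of the subterms of `t` that are variables or
differences. -/
def Term.atomValues {L : Type*} [CoheytingAlgebra L] (x : X → L) : Term X → Set L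
  | var i => {x i}
  | bot => ∅
  | top => ∅
  | sup s t => s.atomValues x ∪ t.atomValues x
  | inf s t => s.atomValues x ∪ t.atomValues x
  | sdiff s t => insert (s.eval x \ t.eval x) (s.atomValues x ∪ t.atomValues x)

theorem Term.finite_atomValues {L : Type*} [CoheytingAlgebra L] (x : X → L) (t : Term X) :
    (t.atomValues x).Finite := by
  induction t with
  | var i => exact Set.finite_singleton _
  | bot => exact Set.finite_empty
  | top => exact Set.finite_empty
  | sup s t hs ht => exact hs.union ht
  | inf s t hs ht => exact hs.union ht
  | sdiff s t hs ht => exact (hs.union ht).insert _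

/-- An injective bounded lattice homomorphism `ι` commutes with the evaluation of `t` as soon as its
range contains the values of all variables and differences that occur in `t`: if `a \ b` is in the range of `ι`,
then it is also the image of the difference taken in the domain of `ι`. -/
theorem Term.map_eval_of_atomValues_subset_range {D L : Type*} [CoheytingAlgebra D]
    [CoheytingAlgebra L] (ι : BoundedLatticeHom D L) (hι : Function.Injective ι) (y : X → D)
    {x : X → L} {t : Term X} (hxy : ∀ i, x i ∈ Set.range ι → ι (y i) = x i)
    (ht : t.atomValues x ⊆ Set.range ι) : ι (t.eval y) = t.eval x := by
  have hle : ∀ {a b : D}, ι a ≤ ι b → a ≤ b := fun {a b} h => by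
    rw [← sup_eq_right, ← map_sup] at h
    exact sup_eq_right.1 (hι h)
  induction t with
  | var i => exact hxy i (ht rfl)
  | bot => exact map_bot ι
  | top => exact map_top ι
  | sup s t hs ht' =>
    obtain ⟨h1, h2⟩ := Set.union_subset_iff.1 ht
    simp only [eval, map_sup, hs h1, ht' h2]
  | inf s t hs ht' =>
    obtain ⟨h1, h2⟩ := Set.union_subset_iff.1 ht
    simp only [eval, map_inf, hs h1, ht' h2]
  | sdiff s t hs ht' =>
    obtain ⟨⟨d, hd⟩, h12⟩ := Set.insert_subset_iff.1 ht
    obtain ⟨h1, h2⟩ := Set.union_subset_iff.1 h12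
    simp only [eval]
    refine le_antisymm ?_ ?_
    · rw [← hd]
      refine OrderHomClass.mono ι (sdiff_le_iff.2 (hle ?_))
      rw [map_sup, hs h1, ht' h2, hd]
      exact le_sup_sdiff
    · rw [sdiff_le_iff, ← hs h1, ← ht' h2, ← map_sup]
      exact OrderHomClass.mono ι le_sup_sdiff

/-- A finite subset of a co-Heyting algebra is contained in the image of a finite co-Heyting algebra
under an injective homomorphism of bounded lattices (which need not preserve differences). -/
theorem exists_finite_boundedLatticeHom {L : Type u} [CoheytingAlgebra L] {S : Set L}
    (hS : S.Finite) :
    ∃ (D : Type u) (_ : CoheytingAlgebra D) (_ : Finite D) (ι : BoundedLatticeHom D L),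
      Function.Injective ι ∧ S ⊆ Set.range ι := by
  let T : Set L := insert ⊥ (insert ⊤ S)
  let D := Sublattice.ofIsSublattice (latticeClosure T) isSublattice_latticeClosure
  have hTD : T ⊆ D := subset_latticeClosure
  have hbot : ⊥ ∈ D := hTD (by simp [T])
  have htop : ⊤ ∈ D := hTD (by simp [T])
  have hfin : Finite D := ((hS.insert ⊤).insert ⊥).latticeClosure.to_subtype
  let _ := Fintype.ofFinite D
  let _ : BoundedOrder D :=
    { bot := ⟨⊥, hbot⟩, top := ⟨⊤, htop⟩, bot_le := fun _ => bot_le (α := L),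
      le_top := fun _ => le_top (α := L) }
  let _ := Fintype.toCompleteDistribLattice D
  exact ⟨D, inferInstance, hfin,
    { toFun := Subtype.val
      map_sup' := fun _ _ => rfl
      map_inf' := fun _ _ => rfl
      map_top' := rfl
      map_bot' := rfl }, Subtype.val_injective,
    fun a ha => ⟨⟨a, hTD (Set.mem_insert_of_mem _ (Set.mem_insert_of_mem _ ha))⟩, rfl⟩⟩

/-- The finite model property: in an algebra with finitely many relations, every nonzero element is
separated from `⊥` by a homomorphism to a finite algebra. -/
theorem Presented.exists_finite_map_ne_bot {R : Set (Term X × Term X)} (hR : R.Finite)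
    {a : Presented R} (ha : a ≠ ⊥) :
    ∃ (D : Type) (_ : CoheytingAlgebra D) (_ : Finite D) (f : CoheytingHom (Presented R) D),
      f a ≠ ⊥ := by
  obtain ⟨t, rfl⟩ := exists_eval_of_eq R a
  let x := of R
  obtain ⟨D, _, hD, ι, hι, hS⟩ := exists_finite_boundedLatticeHom
    ((t.finite_atomValues x).union
      (hR.biUnion fun r _ => (r.1.finite_atomValues x).union (r.2.finite_atomValues x)))
  obtain ⟨htS, hRS⟩ := Set.union_subset_iff.1 hS
  classical
  -- Generators that do not occur in `t` or `R` may be sent anywhere.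
  let y : X → D := fun i => if h : x i ∈ Set.range ι then h.choose else ⊥
  have hxy : ∀ i, x i ∈ Set.range ι → ι (y i) = x i := fun i h => by
    simp only [y, dif_pos h]
    exact h.choose_spec
  have hRy : ∀ r ∈ R, r.1.eval y = r.2.eval y := by
    intro r hr
    obtain ⟨h1, h2⟩ := Set.union_subset_iff.1 ((Set.subset_biUnion_of_mem hr).trans hRS)
    apply hι
    rw [Term.map_eval_of_atomValues_subset_range ι hι y hxy h1,
      Term.map_eval_of_atomValues_subset_range ι hι y hxy h2]
    exact eval_of_eq_of_mem hr
  refine ⟨D, _, hD, lift y hRy, fun h => ha ?_⟩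
  rw [lift_eval_of] at h
  rw [← Term.map_eval_of_atomValues_subset_range ι hι y hxy htS, h, map_bot]

variable {L : Type*} [CoheytingAlgebra L]

theorem FinitelyPresented.finitelyGenerated (hL : FinitelyPresented L) : FinitelyGenerated L := by
  obtain ⟨n, R, -, f, hf⟩ := hL
  refine ⟨n, f ∘ Presented.of R, fun a => ?_⟩
  obtain ⟨b, rfl⟩ := hf.2 a
  obtain ⟨t, rfl⟩ := Presented.exists_eval_of_eq R b
  exact ⟨t, (t.map_eval f _).symm⟩

/-- The inverse of a bijective co-Heyting homomorphism. -/
noncomputable def inverseHom {M : Type*} [CoheytingAlgebra M] (f : CoheytingHom M L)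
    (hf : Function.Bijective f) : CoheytingHom L M :=
  let e := Equiv.ofBijective f hf
  have he : ∀ a, f (e.symm a) = a := e.apply_symm_apply
  { toFun := e.symm
    map_sup' := fun a b => hf.1 (by rw [map_sup f, he, he, he])
    map_inf' := fun a b => hf.1 (by rw [map_inf f, he, he, he])
    map_top' := hf.1 (by rw [map_top f, he])
    map_sdiff' := fun a b => hf.1 (by rw [map_sdiff f, he, he, he]) }

theorem apply_inverseHom {M : Type*} [CoheytingAlgebra M] (f : CoheytingHom M L)
    (hf : Function.Bijective f) (a : L) : f (inverseHom f hf a) = a :=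
  (Equiv.ofBijective f hf).apply_symm_apply a

theorem FinitelyPresented.isHausdorff (hL : FinitelyPresented L) : IsHausdorff L := by
  obtain ⟨n, R, hR, f, hf⟩ := hL
  refine isHausdorff_of_codim_lt_top fun a ha => ?_
  have ha' : inverseHom f hf a ≠ ⊥ := fun h => ha (by rw [← apply_inverseHom f hf a, h, map_bot])
  obtain ⟨D, _, _, g, hg⟩ := Presented.exists_finite_map_ne_bot hR ha'
  exact codim_lt_top_of_map_ne_bot (g.comp (inverseHom f hf)) hg

end FinitePresentation

end CoHeyting

theorem mainTheorem4 (L : Type*) [CoheytingAlgebra L] :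
    (CoHeyting.FinitelyGenerated L → CoHeyting.Precompact L) ∧
    (CoHeyting.FinitelyPresented L → CoHeyting.Precompact L ∧ CoHeyting.IsHausdorff L) :=
  ⟨fun h => h.precompact, fun h => ⟨h.finitelyGenerated.precompact, h.isHausdorff⟩⟩
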